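/- **Theorem 3.1.** Let $m\ge 1$ and let the $n$ entries of a signal $x\in\mathbb{C}^n$ be indexed by a finite abelian group $G$ with $|G|=n$ (e.g. $\mathbb{Z}/n$, or $\mathbb{Z}/n_1\times\mathbb{Z}/n_2$ for images). Let $A=[a_1,\dots,a_m]\in\mathbb{C}^{n\times m}$, $b\in\mathbb{R}^m$ with $b_{\min}=\min_i b_i>0$, and let $x^\natural\in\mathbb{C}^n$ solve the noiseless phase retrieval problem $|a_i^*x^\natural|=b_i$, $i=1,\dots,m$. Put $y^\natural=A^*x^\natural$ and $z^\natural=(x^\natural,y^\natural)\in\mathbb{C}^{n+m}$. Assume: 1. $A^*$ has full column rank; 2. every $x\in\mathbb{C}^n$ with $|a_i^*x|=b_i$ for all $i$ is obtained from $x^\natural$ by trivial ambiguities, i.e. there are $\alpha\in\mathbb{C}$ with $|\alpha|=1$ and $l\in G$ with $x_j=\alpha x^\natural_{j-l}$ for all $j\in G$, or $x_j=\alpha\overline{x^\natural_{l-j}}$ for all $j\in G$; 3. every $x\in\mathbb{C}^n$ with $a_i^*x\neq 0$ and $\frac{a_i^*x}{|a_i^*x|}=\pm\frac{a_i^*x^\natural}{|a_i^*x^\natural|}$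 for all $i$ (the signs may depend on $i$) is of the form $x=cx^\natural$ with $c\in\mathbb{R}\setminus\{0\}$. Graph projection splitting (GPS) without prior ($g=0$) generates, from arbitrary $x^0,\lambda^0\in\mathbb{C}^n$ and $y^0,\nu^0\in\mathbb{C}^m$, for $k\ge 0$, $$(x^{k+\frac12},y^{k+\frac12})=\Pi_{A^*}(x^k-\lambda^k,\,y^k-\nu^k),\qquad x^{k+1}=x^{k+\frac12}+\lambda^k,\qquad y^{k+1}=b\circ\frac{y^{k+\frac12}+\nu^k}{|y^{k+\frac12}+\nu^k|},$$ $$\lambda^{k+1}=\lambda^k+x^{k+\frac12}-x^{k+1},\qquad \nu^{k+1}=\nu^k+y^{k+\frac12}-y^{k+1},$$ where $\Pi_{A^*}$ is the orthogonal projection of $\mathbb{C}^{n+m}$ onto $\{(x,y): A^*x=y\}$, and operations on vectors are entrywise with $0/|0|:=0$. Put $z_{\mathrm{DR}}^k=(\lambda^k+x^k,\ \nu^k+y^k)$, $\operatorname{dist}(x,x^\natural)=\min_{|\alpha|=1}\|x-\alpha x^\natural\|$, and $$\mathcal{F}=\Big\{\Big(\alpha x^\natural,\ \alpha(b+\theta)\circ\tfrac{y^\natural}{|y^\natural|}\Big)\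 :\ |\alpha|=1,\ \theta\in\mathbb{R}^m,\ A\big(\theta\circ\tfrac{y^\natural}{|y^\natural|}\big)=0,\ b+\theta\ge 0\Big\}.$$ Then there are a (sufficiently small) $\varepsilon_3$ with $0<\varepsilon_3<b_{\min}/6$ and a constant $0<\gamma<1$ such that for every GPS iteration with $\|z_{\mathrm{DR}}^1-z^\natural\|\le\varepsilon_3$, the point $z_{\mathrm{DR}}^1$ has a projection (nearest point) onto $\mathcal{F}$, and for every such projection $z_*^1$ and every $k\ge 1$, $$\operatorname{dist}(x^k,x^\natural)\le\gamma^{k-1}\|z_{\mathrm{DR}}^1-z_*^1\|\le\gamma^{k-1}\|z_{\mathrm{DR}}^1-z^\natural\|.$$ -/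

import Mathlib

open scoped Matrix ComplexConjugate

noncomputable section

namespace PhaseRetrieval

variable {G : Type*} [Fintype G] {m : ℕ}

/-- The stacked space `ℂⁿ × ℂᵐ` of pairs `z = (x, y)`, with the Euclidean norm of `ℂⁿ⁺ᵐ`.
The `n` entries of a signal are indexed by a finite type `G`. -/
abbrev Stacked (G : Type*) (m : ℕ) : Type _ :=
  WithLp 2 (EuclideanSpace ℂ G × EuclideanSpace ℂ (Fin m))

/-- The pair `(x, y)` as an element of the stacked space. -/
def stack (x : EuclideanSpace ℂ G) (y : EuclideanSpace ℂ (Fin m)) : Stacked G m :=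
  WithLp.toLp 2 (x, y)

/-- `A* x`, whose `i`-th entry is `aᵢ* x`, where `aᵢ` is the `i`-th column of `A`. -/
def meas (A : Matrix G (Fin m) ℂ) (x : EuclideanSpace ℂ G) : EuclideanSpace ℂ (Fin m) :=
  WithLp.toLp 2 (Aᴴ *ᵥ x.ofLp)

/-- `b_min = min {b₁, …, b_m}`. (It is `0` if `m = 0`, so `0 < bMin b` includes `m ≥ 1`.) -/
def bMin (b : Fin m → ℝ) : ℝ := ⨅ i, b i

/-- The phase `y / |y|` of a complex number, with value `0` at `y = 0`. -/
def phase (y : ℂ) : ℂ := y / (‖y‖ : ℂ)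

/-- `x` solves the noiseless phase retrieval problem `|aᵢ* x| = bᵢ` for all `i`. -/
def IsSolution (A : Matrix G (Fin m) ℂ) (b : Fin m → ℝ) (x : EuclideanSpace ℂ G) : Prop :=
  ∀ i, ‖meas A x i‖ = b i

/-- `x'` arises from `x` by the trivial ambiguities: a global phase shift `α`, a (cyclic)
translation by `l`, and possibly a (conjugate) mirror flip. The entries of a signal are indexed
by a finite abelian group, such as `ℤ/n` for one-dimensional signals or `ℤ/n₁ × ℤ/n₂` for
images. -/
def TriviallyEquivalent [AddCommGroup G] (x x' : EuclideanSpace ℂ G) : Prop :=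
  ∃ α : ℂ, ‖α‖ = 1 ∧ ∃ l : G,
    (∀ j, x' j = α * x (j - l)) ∨ (∀ j, x' j = α * conj (x (l - j)))

/-- The assumption on the sampling vectors. -/
structure SamplingAssumption [AddCommGroup G] (A : Matrix G (Fin m) ℂ) (b : Fin m → ℝ)
    (xnat : EuclideanSpace ℂ G) : Prop where
  /-- `A*` has full column rank. -/
  full_rank : Aᴴ.rank = Fintype.card G
  /-- The solution of phase retrieval is unique up to the trivial ambiguities. -/
  phase_unique : ∀ x, IsSolution A b x → TriviallyEquivalent xnat x
  /-- The solution of magnitude retrieval is unique up to a nonzero real factor. -/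
  magnitude_unique : ∀ x : EuclideanSpace ℂ G,
    (∀ i, phase (meas A x i) = phase (meas A xnat i) ∨
      phase (meas A x i) = -phase (meas A xnat i)) →
    ∃ c : ℝ, c ≠ 0 ∧ x = (c : ℂ) • xnat

/-- The graph set `C = {(x, y) | A* x = y}`, a complex subspace of the stacked space. -/
def graphSet (A : Matrix G (Fin m) ℂ) : Submodule ℂ (Stacked G m) where
  carrier := {z | meas A z.fst = z.snd}
  add_mem' := by
    intro z w hz hw
    simp only [Set.mem_ofPred_eq, meas, WithLp.add_fst, WithLp.add_snd] at *
    rw [← hz, ← hw, WithLp.ofLp_add, Matrix.mulVec_add, WithLp.toLp_add]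
  zero_mem' := by
    simp [meas]
  smul_mem' := by
    intro c z hz
    simp only [Set.mem_ofPred_eq, meas, WithLp.smul_fst, WithLp.smul_snd] at *
    rw [← hz, WithLp.ofLp_smul, Matrix.mulVec_smul, WithLp.toLp_smul]

/-- The graph projection, i.e. the orthogonal projection onto the graph set. -/
def graphProj (A : Matrix G (Fin m) ℂ) (z : Stacked G m) : Stacked G m :=
  (graphSet A).starProjection z

/-- The proximity operator of the indicator function `f` of `{y | |y| = b}`:
`prox_f(y) = b ∘ y / |y|`, with the convention `yᵢ / |yᵢ| = 0` where `yᵢ = 0`. -/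
def proxF (b : Fin m → ℝ) (y : EuclideanSpace ℂ (Fin m)) : EuclideanSpace ℂ (Fin m) :=
  WithLp.toLp 2 fun i => (b i : ℂ) * phase (y i)

/-- The proximity operator of `g = 0`, the minimizer of `p ↦ ρ / 2 * ‖p - x‖ ^ 2`. -/
def proxG (x : EuclideanSpace ℂ G) : EuclideanSpace ℂ G := x

/-- The sequences `xᵏ, yᵏ` (primal), `lamᵏ, nuᵏ` (dual) and `xhᵏ = x^{k+1/2}, yhᵏ = y^{k+1/2}`
are generated by graph projection splitting with `g = 0`, from arbitrary initial values
`x⁰, y⁰, lam⁰, nu⁰`. -/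
structure IsGPS (A : Matrix G (Fin m) ℂ) (b : Fin m → ℝ)
    (x xh lam : ℕ → EuclideanSpace ℂ G) (y yh nu : ℕ → EuclideanSpace ℂ (Fin m)) : Prop where
  graph_step : ∀ k, stack (xh k) (yh k) = graphProj A (stack (x k - lam k) (y k - nu k))
  prox_x : ∀ k, x (k + 1) = proxG (xh k + lam k)
  prox_y : ∀ k, y (k + 1) = proxF b (yh k + nu k)
  dual_x : ∀ k, lam (k + 1) = lam k + xh k - x (k + 1)
  dual_y : ∀ k, nu (k + 1) = nu k + yh k - y (k + 1)

/-- The set `𝓕` of the points `(α x♮, α (b + θ) ∘ y♮ / |y♮|)` with `y♮ = A* x♮`, `|α| = 1`,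
`θ ∈ ℝᵐ`, `A (θ ∘ y♮ / |y♮|) = 0` and `b + θ ≥ 0`. -/
def fixedSet (A : Matrix G (Fin m) ℂ) (b : Fin m → ℝ) (xnat : EuclideanSpace ℂ G) :
    Set (Stacked G m) :=
  {z | ∃ (α : ℂ) (θ : Fin m → ℝ), ‖α‖ = 1 ∧
    A *ᵥ (fun i => (θ i : ℂ) * phase (meas A xnat i)) = 0 ∧
    (∀ i, 0 ≤ b i + θ i) ∧
    z = stack (α • xnat)
      (WithLp.toLp 2 fun i => α * ((b i + θ i : ℝ) : ℂ) * phase (meas A xnat i))}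

/-- `p` is a projection of `z` onto the set `S`, i.e. `p ∈ argmin_{q ∈ S} ‖q - z‖²`. -/
def IsProjOn (S : Set (Stacked G m)) (z p : Stacked G m) : Prop :=
  p ∈ S ∧ ∀ q ∈ S, ‖p - z‖ ^ 2 ≤ ‖q - z‖ ^ 2

/-- `dist(x, x♮) = min_{|α| = 1} ‖x - α x♮‖`. -/
def phaseDist (x xnat : EuclideanSpace ℂ G) : ℝ :=
  ⨅ α : Circle, ‖x - (α : ℂ) • xnat‖

end PhaseRetrieval

end

noncomputable section

namespace PhaseRetrieval

variable {G : Type*} {m : ℕ}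

/-! ### The stacked space -/

/-! After the first step `λ = 0`, and GPS becomes the Douglas–Rachford iteration `z ↦ (z + R_C R_f
z) / 2` (`IsGPS.drStep_eq`), where `R_C` reflects in the graph and `R_f = 2 prox - id`. Write `u =
y♮ / |y♮|`. The points of `fixedSet` with `b + θ > 0` are fixed by this map.

Near the solution, `R_f` agrees up to a small relative error with the real-linear reflection
`phaseRefl`, which does not depend on `θ`. The linearized operator `drLin` averages the identity
with an isometry, so `‖Lv‖² + ‖v - Lv‖² = ‖v‖²`. By compactness it is a strict contraction on the
space normal to `fixedSet`, provided that it fixes no nonzero normal vector. This is where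
uniqueness of magnitude retrieval enters (`eq_zero_of_drLin_eq_self`): a fixed normal vector yields
a perturbation of `x♮` whose measurements have the same phases, hence a multiple of `x♮`, so the
vector is tangent to the phase orbit and therefore zero.

The displacement from a nearest point is normal there, so one nonlinear step contracts towards that
point (`exists_norm_drStep_sub_le`). Nearest points change along the iteration, but a geometric
series bounds the total drift and keeps the iterates in the good ball
(`norm_sub_le_of_local_contraction`). -/

@[simp] theorem stack_fst (x : EuclideanSpace ℂ G) (y : EuclideanSpace ℂ (Fin m)) :
    (stack x y).fst = x := rfl

@[simp] theorem stack_snd (x : EuclideanSpace ℂ G) (y : EuclideanSpace ℂ (Fin m)) :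
    (stack x y).snd = y := rfl

theorem stacked_ext {z w : Stacked G m} (h₁ : z.fst = w.fst) (h₂ : ∀ i, z.snd i = w.snd i) :
    z = w := by
  have h₃ : z.snd = w.snd := by ext i; exact h₂ i
  exact WithLp.ofLp_injective 2 (Prod.ext h₁ h₃)

variable [Fintype G]

theorem norm_sq_stacked (z : Stacked G m) : ‖z‖ ^ 2 = ‖z.fst‖ ^ 2 + ∑ i, ‖z.snd i‖ ^ 2 := by
  rw [WithLp.prod_norm_sq_eq_of_L2, EuclideanSpace.norm_sq_eq z.snd]

theorem norm_fst_le (z : Stacked G m) : ‖z.fst‖ ≤ ‖z‖ := by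
  refine le_of_sq_le_sq ?_ (norm_nonneg _)
  rw [norm_sq_stacked z]
  exact le_add_of_nonneg_right (Finset.sum_nonneg fun i _ => sq_nonneg _)

theorem norm_snd_le (z : Stacked G m) (i : Fin m) : ‖z.snd i‖ ≤ ‖z‖ := by
  refine le_of_sq_le_sq ?_ (norm_nonneg _)
  rw [norm_sq_stacked z]
  exact le_add_of_nonneg_of_le (sq_nonneg _)
    (Finset.single_le_sum (f := fun i => ‖z.snd i‖ ^ 2) (fun i _ => sq_nonneg _)
      (Finset.mem_univ i))

theorem norm_stacked_le {z w : Stacked G m} {c : ℝ} (hc : 0 ≤ c) (h₁ : ‖z.fst‖ ≤ c * ‖w.fst‖)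
    (h₂ : ∀ i, ‖z.snd i‖ ≤ c * ‖w.snd i‖) : ‖z‖ ≤ c * ‖w‖ := by
  refine le_of_sq_le_sq ?_ (by positivity)
  rw [mul_pow, norm_sq_stacked z, norm_sq_stacked w, mul_add, Finset.mul_sum]
  refine add_le_add ?_ (Finset.sum_le_sum fun i _ => ?_)
  · rw [← mul_pow]; exact pow_le_pow_left₀ (norm_nonneg _) h₁ 2
  · rw [← mul_pow]; exact pow_le_pow_left₀ (norm_nonneg _) (h₂ i) 2

theorem inner_stacked (z w : Stacked G m) :
    inner ℂ z w = inner ℂ z.fst w.fst + ∑ i, w.snd i * conj (z.snd i) := by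
  rw [WithLp.prod_inner_apply]
  congr 1

theorem properSpace_stacked : ProperSpace (Stacked G m) :=
  FiniteDimensional.proper ℂ _

/-! ### Phases -/

theorem phase_smul {α : ℂ} (hα : ‖α‖ = 1) (y : ℂ) : phase (α * y) = α * phase y := by
  simp [phase, hα, mul_div_assoc]

theorem norm_phase {y : ℂ} (hy : y ≠ 0) : ‖phase y‖ = 1 := by
  simp [phase, hy]

theorem norm_mul_phase (y : ℂ) : (‖y‖ : ℂ) * phase y = y := by
  by_cases hy : y = 0
  · simp [hy, phase]
  · have : (‖y‖ : ℂ) ≠ 0 := by simpa using hy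
    rw [phase, mul_div_cancel₀ _ this]

theorem phase_real_mul {u : ℂ} (hu : ‖u‖ = 1) {r : ℝ} (hr : 0 < r) : phase (r * u) = u := by
  have : (r : ℂ) ≠ 0 := by exact_mod_cast hr.ne'
  simp [phase, hu, abs_of_pos hr]
  field_simp

theorem mul_conj_eq_one {u : ℂ} (hu : ‖u‖ = 1) : u * conj u = 1 := by
  rw [Complex.mul_conj, Complex.normSq_eq_norm_sq, hu]; simp

/-- First-order expansion of `w ↦ c • phase w` along the ray of positive reals. -/
theorem norm_phase_sub_linear_one_le {c ρ ε : ℝ} {v : ℂ} (hc : 0 < c) (hε : 6 * ε ≤ c)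
    (hρ : |ρ - c| ≤ 2 * ε) (hv : ‖v‖ ≤ ε) :
    ‖(c : ℂ) * phase (ρ + v) - c - (v - conj v) / 2‖ ≤ 10 * ε / c * ‖v‖ := by
  set s : ℝ := ‖(ρ : ℂ) + v‖ with hs
  have hε0 : 0 ≤ ε := (norm_nonneg v).trans hv
  have hsc : |s - c| ≤ 3 * ε := by
    have h1 : |s - ‖(c : ℂ)‖| ≤ ‖(ρ : ℂ) + v - c‖ := abs_norm_sub_norm_le _ _
    rw [Complex.norm_real, Real.norm_of_nonneg hc.le] at h1
    have h2 : ‖(ρ : ℂ) + v - c‖ ≤ ‖((ρ - c : ℝ) : ℂ)‖ + ‖v‖ := by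
      refine le_trans (le_of_eq ?_) (norm_add_le _ _)
      congr 1; push_cast; ring
    rw [Complex.norm_real, Real.norm_eq_abs] at h2
    linarith
  have hs2 : c / 2 ≤ s := by linarith [(abs_le.1 hsc).1]
  have hs0 : 0 < s := by linarith
  have hre : |v.re| ≤ ε := (Complex.abs_re_le_norm v).trans hv
  have him : |v.im| ≤ ‖v‖ := Complex.abs_im_le_norm v
  set p : ℝ := ρ + v.re with hp
  have hp0 : 0 ≤ p := by linarith [(abs_le.1 hρ).1, (abs_le.1 hre).1]
  have hss : s ^ 2 = p ^ 2 + v.im ^ 2 := by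
    rw [hs, ← Complex.normSq_eq_norm_sq, Complex.normSq_apply]
    simp [hp]; ring
  have hsC : (s : ℂ) ≠ 0 := by exact_mod_cast hs0.ne'
  -- As `(v - conj v) / 2 = i Im v`, the error splits into a real part that is quadratic in `v` and
  -- an imaginary part that is small because `s` is near `c`. Using the coefficient 1 instead of `c
  -- / ρ` makes the linear term independent of `ρ`.
  have key : (c : ℂ) * phase (ρ + v) - c - (v - conj v) / 2
      = ((c * (p - s) / s : ℝ) : ℂ) + ((v.im * ((c - s) / s) : ℝ) : ℂ) * Complex.I := by
    have hph : phase (ρ + v) = (ρ + v) / s := rfl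
    have hvv : v = v.re + v.im * Complex.I := (Complex.re_add_im v).symm
    rw [hph, Complex.sub_conj]
    rw [show (ρ + v : ℂ) = p + v.im * Complex.I by
      rw [hp]; push_cast; conv_lhs => rw [hvv]
      ring]
    push_cast
    field_simp
    ring
  have hps : |p - s| ≤ 2 * ε / c * ‖v‖ := by
    have hle : p ≤ s := by
      refine le_of_sq_le_sq ?_ hs0.le
      nlinarith [sq_nonneg v.im]
    -- From `(s - p) (s + p) = v.im ^ 2` and `p ≥ 0`.
    have h3 : (s - p) * s ≤ ε * ‖v‖ := by
      have h4 : v.im ^ 2 ≤ ε * ‖v‖ := by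
        rw [← sq_abs]
        nlinarith [abs_nonneg v.im, norm_nonneg v]
      nlinarith
    rw [abs_sub_comm, abs_of_nonneg (by linarith)]
    have h5 : (s - p) * c ≤ 2 * ε * ‖v‖ := by
      nlinarith
    rw [div_mul_eq_mul_div, le_div_iff₀ hc]
    exact h5
  have hcs : c / s ≤ 2 := by rw [div_le_iff₀ hs0]; linarith
  have h6 : ‖((c * (p - s) / s : ℝ) : ℂ)‖ ≤ 4 * ε / c * ‖v‖ := by
    rw [Complex.norm_real, Real.norm_eq_abs, mul_div_right_comm, abs_mul,
      abs_of_pos (div_pos hc hs0)]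
    calc c / s * |p - s| ≤ 2 * (2 * ε / c * ‖v‖) := by gcongr
      _ = 4 * ε / c * ‖v‖ := by ring
  have h7 : ‖((v.im * ((c - s) / s) : ℝ) : ℂ) * Complex.I‖ ≤ 6 * ε / c * ‖v‖ := by
    rw [norm_mul, Complex.norm_I, mul_one, Complex.norm_real, Real.norm_eq_abs, abs_mul, abs_div,
      abs_of_pos hs0, abs_sub_comm c s]
    have h8 : |s - c| / s ≤ 6 * ε / c := by
      rw [div_le_div_iff₀ hs0 hc]
      nlinarith [abs_nonneg (s - c)]
    calc |v.im| * (|s - c| / s) ≤ ‖v‖ * (6 * ε / c) := by gcongr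
      _ = _ := by ring
  rw [key]
  calc _ ≤ 4 * ε / c * ‖v‖ + 6 * ε / c * ‖v‖ := (norm_add_le _ _).trans (add_le_add h6 h7)
    _ = _ := by ring

/-- Multiplication by `conj u` rotates the ray through `u` to the positive reals. The linear term is
the component of `v` perpendicular to `u`. -/
theorem norm_phase_sub_linear_le {c ρ ε : ℝ} {u v : ℂ} (hu : ‖u‖ = 1) (hc : 0 < c)
    (hε : 6 * ε ≤ c) (hρ : |ρ - c| ≤ 2 * ε) (hv : ‖v‖ ≤ ε) :
    ‖(c : ℂ) * phase (ρ * u + v) - c * u - (v - u ^ 2 * conj v) / 2‖ ≤ 10 * ε / c * ‖v‖ := by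
  have huu := mul_conj_eq_one hu
  have hn : ‖conj u * v‖ = ‖v‖ := by simp [hu]
  have h := norm_phase_sub_linear_one_le (v := conj u * v) hc hε hρ (by rwa [hn])
  rw [hn] at h
  refine le_trans (le_of_eq ?_) h
  rw [← one_mul ‖(c : ℂ) * phase (ρ + conj u * v) - c - _‖, ← hu, ← norm_mul]
  congr 1
  have h1 : (ρ * u + v : ℂ) = u * (ρ + conj u * v) := by
    linear_combination (-v) * huu
  rw [h1, phase_smul hu, map_mul, Complex.conj_conj]
  linear_combination (v / 2) * huu

end PhaseRetrieval
end

noncomputable section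

namespace PhaseRetrieval

variable {G : Type*} {m : ℕ}

/-! ### The linearized Douglas–Rachford operator -/

/-- The reflection `(x, y) ↦ (x, -u² ∘ conj y)` in the real subspace of the pairs `(x, y)` with
`y ∈ i ℝᵐ ∘ u`, for unimodular `u`. -/
def phaseRefl (u : Fin m → ℂ) (z : Stacked G m) : Stacked G m :=
  stack z.fst (WithLp.toLp 2 fun i => -(u i) ^ 2 * conj (z.snd i))

@[simp] theorem phaseRefl_fst (u : Fin m → ℂ) (z : Stacked G m) :
    (phaseRefl u z).fst = z.fst := rfl

@[simp] theorem phaseRefl_snd (u : Fin m → ℂ) (z : Stacked G m) (i : Fin m) :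
    (phaseRefl u z).snd i = -(u i) ^ 2 * conj (z.snd i) := rfl

theorem phaseRefl_add (u : Fin m → ℂ) (z w : Stacked G m) :
    phaseRefl u (z + w) = phaseRefl u z + phaseRefl u w := by
  refine stacked_ext (by simp) fun i => ?_
  simp
  ring

theorem phaseRefl_real_smul (u : Fin m → ℂ) (t : ℝ) (z : Stacked G m) :
    phaseRefl u ((t : ℂ) • z) = (t : ℂ) • phaseRefl u z := by
  refine stacked_ext (by simp) fun i => ?_
  simp
  ring

variable [Fintype G]

theorem norm_phaseRefl {u : Fin m → ℂ} (hu : ∀ i, ‖u i‖ = 1) (z : Stacked G m) :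
    ‖phaseRefl u z‖ = ‖z‖ := by
  rw [← sq_eq_sq₀ (norm_nonneg _) (norm_nonneg _), norm_sq_stacked, norm_sq_stacked z]
  simp [hu]

/-- The Douglas–Rachford operator of the graph set and of the subspace of `phaseRefl`. -/
def drLin (A : Matrix G (Fin m) ℂ) (u : Fin m → ℂ) (z : Stacked G m) : Stacked G m :=
  (1 / 2 : ℂ) • (z + (graphSet A).reflection (phaseRefl u z))

theorem drLin_add (A : Matrix G (Fin m) ℂ) (u : Fin m → ℂ) (z w : Stacked G m) :
    drLin A u (z + w) = drLin A u z + drLin A u w := by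
  simp only [drLin, phaseRefl_add, map_add]
  module

theorem drLin_real_smul (A : Matrix G (Fin m) ℂ) (u : Fin m → ℂ) (t : ℝ) (z : Stacked G m) :
    drLin A u ((t : ℂ) • z) = (t : ℂ) • drLin A u z := by
  simp only [drLin, phaseRefl_real_smul, map_smul]
  module

/-- The parallelogram law for `z` and its norm-preserving image `r`. Consequently a vector whose
norm does not drop is fixed. -/
theorem norm_drLin_sq_add {u : Fin m → ℂ} (hu : ∀ i, ‖u i‖ = 1) (A : Matrix G (Fin m) ℂ)
    (z : Stacked G m) : ‖drLin A u z‖ ^ 2 + ‖z - drLin A u z‖ ^ 2 = ‖z‖ ^ 2 := by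
  set r := (graphSet A).reflection (phaseRefl u z) with hr
  have hn : ‖r‖ = ‖z‖ := by rw [hr, LinearIsometryEquiv.norm_map, norm_phaseRefl hu]
  have h1 : drLin A u z = (1 / 2 : ℂ) • (z + r) := rfl
  have h2 : z - drLin A u z = (1 / 2 : ℂ) • (z - r) := by rw [h1]; module
  have hp := parallelogram_law_with_norm ℂ z r
  rw [h2, h1, norm_smul, norm_smul, mul_pow, mul_pow]
  rw [hn] at hp
  norm_num
  linarith

theorem norm_drLin_le {u : Fin m → ℂ} (hu : ∀ i, ‖u i‖ = 1) (A : Matrix G (Fin m) ℂ)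
    (z : Stacked G m) : ‖drLin A u z‖ ≤ ‖z‖ := by
  refine le_of_sq_le_sq ?_ (norm_nonneg _)
  linarith [norm_drLin_sq_add hu A z, sq_nonneg ‖z - drLin A u z‖]

theorem continuous_drLin {u : Fin m → ℂ} (hu : ∀ i, ‖u i‖ = 1) (A : Matrix G (Fin m) ℂ) :
    Continuous (drLin A u : Stacked G m → Stacked G m) := by
  have hL : LipschitzWith 1 (drLin A u : Stacked G m → Stacked G m) := by
    refine LipschitzWith.of_dist_le_mul fun z w => ?_
    rw [dist_eq_norm, dist_eq_norm, NNReal.coe_one, one_mul]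
    have h : drLin A u z = drLin A u w + drLin A u (z - w) := by
      rw [← drLin_add]; congr 1; abel
    rw [h, add_sub_cancel_left]
    exact norm_drLin_le hu A _
  exact hL.continuous

/-- Pairing with the graph vectors `(e_j, A* e_j)` reads off the entries of `A y`. -/
theorem mulVec_eq_zero_of_mem_orthogonal {A : Matrix G (Fin m) ℂ} {y : EuclideanSpace ℂ (Fin m)}
    (h : stack 0 y ∈ (graphSet A)ᗮ) : A *ᵥ y.ofLp = 0 := by
  classical
  funext j
  have hmem : stack (EuclideanSpace.single j 1) (meas A (EuclideanSpace.single j 1)) ∈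
      graphSet A := rfl
  have h1 := (Submodule.mem_orthogonal _ _).1 h _ hmem
  rw [inner_stacked] at h1
  simpa [meas, Matrix.mulVec, dotProduct, mul_comm] using h1

/-- The vectors that are orthogonal (over `ℝ`) to the tangent space of `fixedSet` at the
solution. -/
def normalSet (A : Matrix G (Fin m) ℂ) (u : Fin m → ℂ) (z₀ : Stacked G m) : Set (Stacked G m) :=
  {v | (inner ℂ z₀ v).im = 0 ∧ ∀ η : Fin m → ℝ, A *ᵥ (fun i => (η i : ℂ) * u i) = 0 →
    ∑ i, η i * (conj (u i) * v.snd i).re = 0}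

theorem isClosed_normalSet (A : Matrix G (Fin m) ℂ) (u : Fin m → ℂ) (z₀ : Stacked G m) :
    IsClosed (normalSet A u z₀) := by
  have hsnd : ∀ i, Continuous fun v : Stacked G m => v.snd i := fun i =>
    (PiLp.continuous_apply 2 _ i).comp (WithLp.prod_continuous_ofLp 2 _ _).snd
  rw [normalSet, Set.ofPred_and]
  refine IsClosed.inter (isClosed_eq (by fun_prop) continuous_const) ?_
  simp only [Set.ofPred_forall]
  exact isClosed_iInter fun η => isClosed_iInter fun _ => isClosed_eq
    (continuous_finsetSum _ fun i _ => continuous_const.mul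
      (Complex.continuous_re.comp (continuous_const.mul (hsnd i)))) continuous_const

theorem real_smul_mem_normalSet {A : Matrix G (Fin m) ℂ} {u : Fin m → ℂ} {z₀ v : Stacked G m}
    (hv : v ∈ normalSet A u z₀) (t : ℝ) : (t : ℂ) • v ∈ normalSet A u z₀ := by
  refine ⟨?_, fun η hη => ?_⟩
  · rw [inner_smul_right, Complex.im_ofReal_mul, hv.1, mul_zero]
  · have h : ∀ i, η i * (conj (u i) * ((t : ℂ) • v).snd i).re =
        t * (η i * (conj (u i) * v.snd i).re) := fun i => by
      simp
      ring
    simp only [h, ← Finset.mul_sum, hv.2 η hη, mul_zero]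

variable {A : Matrix G (Fin m) ℂ} {b : Fin m → ℝ} {xnat : EuclideanSpace ℂ G}

/-- The fixed points of the linearized operator in the normal space are trivial. -/
theorem eq_zero_of_drLin_eq_self (hb : ∀ i, 0 < b i) (hne : xnat ≠ 0)
    (hsol : IsSolution A b xnat)
    (hmag : ∀ x : EuclideanSpace ℂ G,
      (∀ i, phase (meas A x i) = phase (meas A xnat i) ∨
        phase (meas A x i) = -phase (meas A xnat i)) →
      ∃ c : ℝ, c ≠ 0 ∧ x = (c : ℂ) • xnat)
    {v : Stacked G m}
    (hv : v ∈ normalSet A (fun i => phase (meas A xnat i)) (stack xnat (meas A xnat)))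
    (hfix : drLin A (fun i => phase (meas A xnat i)) v = v) : v = 0 := by
  set u : Fin m → ℂ := fun i => phase (meas A xnat i) with hu_def
  have hy : ∀ i, meas A xnat i = b i * u i := fun i => by
    rw [← hsol i, hu_def, norm_mul_phase]
  have hu : ∀ i, ‖u i‖ = 1 := fun i => norm_phase fun h => by
    have := hsol i
    rw [h, norm_zero] at this
    exact (hb i).ne this
  have hr : (graphSet A).reflection (phaseRefl u v) = v := by
    have h1 : (1 / 2 : ℂ) • (v + (graphSet A).reflection (phaseRefl u v)) = v := hfix
    have h2 : (graphSet A).reflection (phaseRefl u v) =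
      (2 : ℂ) • ((1 / 2 : ℂ) • (v + (graphSet A).reflection (phaseRefl u v))) - v := by module
    rw [h2, h1]; module
  have hr' : phaseRefl u v = (graphSet A).reflection v := by
    conv_rhs => rw [← hr]
    rw [Submodule.reflection_reflection]
  -- For a fixed vector, the graph projection keeps the `x`-part and only the part of `y`
  -- perpendicular to `u`. The remainder is the radial vector `(0, η ∘ u)`, which is thus orthogonal
  -- to the graph.
  have hp : (graphSet A).starProjection v = (1 / 2 : ℂ) • (v + phaseRefl u v) := by
    rw [hr', Submodule.reflection_apply]; module
  set η : Fin m → ℝ := fun i => (conj (u i) * v.snd i).re with hη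
  have hηu : ∀ i, (η i : ℂ) * u i = (v.snd i + u i ^ 2 * conj (v.snd i)) / 2 := fun i => by
    have h1 : (η i : ℂ) = (conj (u i) * v.snd i + conj (conj (u i) * v.snd i)) / 2 := by
      rw [hη, Complex.add_conj]; push_cast; ring
    rw [h1, map_mul, Complex.conj_conj]
    linear_combination (v.snd i / 2) * mul_conj_eq_one (hu i)
  have hA0 : A *ᵥ (fun i => (η i : ℂ) * u i) = 0 := by
    refine mulVec_eq_zero_of_mem_orthogonal
      (y := WithLp.toLp 2 fun i => (η i : ℂ) * u i) ?_
    have h1 := (graphSet A).sub_starProjection_mem_orthogonal v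
    rw [hp] at h1
    convert h1 using 1
    refine stacked_ext ?_ fun i => ?_
    · simp; module
    · simp [hηu i]; ring
  -- `η` is itself an admissible direction in `normalSet`, so the condition there reads `∑ η i ^ 2 =
  -- 0`.
  have hη0 : ∀ i, η i = 0 := by
    have h1 := hv.2 η hA0
    have h2 : ∑ i, η i * η i = 0 := h1
    intro i
    exact mul_self_eq_zero.1 ((Finset.sum_eq_zero_iff_of_nonneg
      fun i _ => mul_self_nonneg (η i)).1 h2 i (Finset.mem_univ i))
  have hvC : meas A v.fst = v.snd := by
    have h1 : v ∈ graphSet A := by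
      rw [← Submodule.starProjection_eq_self_iff, hp]
      refine stacked_ext ?_ fun i => ?_
      · simp; module
      · have := hηu i
        rw [hη0 i] at this
        simp
        push_cast at this
        linear_combination this
    exact h1
  set τ : Fin m → ℝ := fun i => (conj (u i) * v.snd i).im with hτ
  have hvτ : ∀ i, v.snd i = Complex.I * τ i * u i := fun i => by
    have h1 : conj (u i) * v.snd i = Complex.I * τ i := by
      apply Complex.ext
      · rw [show (conj (u i) * v.snd i).re = 0 from hη0 i]; simp
      · simp [hτ]
    linear_combination (-(v.snd i)) * mul_conj_eq_one (hu i) + u i * h1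
  -- Now `A* v.fst = i τ ∘ u`. Moving `x♮` by `-i s v.fst` changes the magnitudes to `b + s τ`, and
  -- a small `s` keeps them positive, so all phases are unchanged.
  obtain ⟨s, hs0, hs⟩ : ∃ s : ℝ, 0 < s ∧ ∀ i, 0 < b i + s * τ i := by
    have hev : ∀ i, ∀ᶠ s : ℝ in nhdsWithin 0 (Set.Ioi 0), 0 < b i + s * τ i := fun i => by
      have hcont : Filter.Tendsto (fun s : ℝ => b i + s * τ i) (nhds 0) (nhds (b i + 0 * τ i)) :=
        (by fun_prop : Continuous fun s : ℝ => b i + s * τ i).tendsto 0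
      exact nhdsWithin_le_nhds (hcont.eventually (lt_mem_nhds (by simpa using hb i)))
    obtain ⟨s, h1, h2⟩ := ((Filter.eventually_all.2 hev).and self_mem_nhdsWithin).exists
    exact ⟨s, h2, h1⟩
  have hlin : meas A (xnat - (s * Complex.I : ℂ) • v.fst) =
      meas A xnat - (s * Complex.I : ℂ) • meas A v.fst := by
    simp [meas, Matrix.mulVec_sub, Matrix.mulVec_smul]
  obtain ⟨c, -, hc⟩ := hmag (xnat - (s * Complex.I : ℂ) • v.fst) fun i => Or.inl <| by
    have h1 : meas A (xnat - (s * Complex.I : ℂ) • v.fst) i = ((b i + s * τ i : ℝ) : ℂ) * u i := by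
      rw [hlin, hvC]
      simp only [PiLp.sub_apply, PiLp.smul_apply, smul_eq_mul, hy, hvτ i]
      push_cast
      linear_combination (-(s * τ i * u i : ℂ)) * Complex.I_sq
    rw [h1, phase_real_mul (hu i) (hs i)]
  set κ : ℝ := (c - 1) / s with hκ
  have hs' : (s : ℂ) ≠ 0 := by exact_mod_cast hs0.ne'
  have hx : v.fst = ((κ : ℂ) * Complex.I) • xnat := by
    have h1 : (s * Complex.I : ℂ) • v.fst = ((1 - c : ℝ) : ℂ) • xnat := by
      have : (s * Complex.I : ℂ) • v.fst = xnat - (xnat - (s * Complex.I : ℂ) • v.fst) := by abel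
      rw [this, hc]; push_cast; module
    have h2 : v.fst = (-Complex.I / s : ℂ) • ((s * Complex.I : ℂ) • v.fst) := by
      rw [smul_smul]
      have : (-Complex.I / s * (s * Complex.I) : ℂ) = 1 := by
        field_simp; simp
      rw [this, one_smul]
    rw [h2, h1, smul_smul]
    congr 1
    rw [hκ]; push_cast; field_simp; ring
  have hvz : v = ((κ : ℂ) * Complex.I) • stack xnat (meas A xnat) := by
    refine stacked_ext hx fun i => ?_
    rw [← hvC, hx]
    simp [meas, Matrix.mulVec_smul]
  -- `v` is `κ` times the tangent of the phase orbit at the solution, and the first normality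
  -- condition forces `κ = 0`.
  have h0 := hv.1
  rw [hvz, inner_smul_right, inner_self_eq_norm_sq_to_K] at h0
  have hz0 : ‖stack xnat (meas A xnat)‖ ≠ 0 := by
    intro h
    have := norm_fst_le (stack xnat (meas A xnat))
    rw [h] at this
    exact hne (norm_le_zero_iff.1 this)
  have hκ0 : κ = 0 := by
    have h3 : ((κ : ℂ) * Complex.I * ((‖stack xnat (meas A xnat)‖ : ℝ) : ℂ) ^ 2).im
        = κ * ‖stack xnat (meas A xnat)‖ ^ 2 := by
      rw [mul_assoc, Complex.im_ofReal_mul, ← Complex.ofReal_pow, Complex.im_mul_ofReal,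
        Complex.I_im, one_mul]
    simpa [hz0] using h3.symm.trans h0
  rw [hvz, hκ0]; simp

/-- The linearized operator is a contraction on the normal space. -/
theorem exists_norm_drLin_le {u : Fin m → ℂ} (hu : ∀ i, ‖u i‖ = 1) {z₀ : Stacked G m}
    (h : ∀ v ∈ normalSet A u z₀, drLin A u v = v → v = 0) :
    ∃ γ : ℝ, 0 ≤ γ ∧ γ < 1 ∧ ∀ v ∈ normalSet A u z₀, ‖drLin A u v‖ ≤ γ * ‖v‖ := by
  have := properSpace_stacked (G := G) (m := m)
  -- By homogeneity the unit sphere suffices. The maximum over it is attained, and the value 1 would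
  -- make the maximizer a fixed vector of norm 1.
  set K : Set (Stacked G m) := Metric.sphere 0 1 ∩ normalSet A u z₀
  have hK : IsCompact K := (isCompact_sphere 0 1).inter_right (isClosed_normalSet A u z₀)
  have hscale : ∀ γ : ℝ, (∀ v ∈ K, ‖drLin A u v‖ ≤ γ) →
      ∀ v ∈ normalSet A u z₀, ‖drLin A u v‖ ≤ γ * ‖v‖ := fun γ hγ v hv => by
    by_cases hv0 : v = 0
    · simpa [hv0] using norm_drLin_le hu A (0 : Stacked G m)
    · have hn : 0 < ‖v‖ := norm_pos_iff.2 hv0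
      have h1 := hγ (((‖v‖⁻¹ : ℝ) : ℂ) • v) ⟨by simp [norm_smul, hn.ne'],
        real_smul_mem_normalSet hv _⟩
      rw [drLin_real_smul, norm_smul, Complex.norm_real, norm_inv, norm_norm,
        inv_mul_le_iff₀ hn] at h1
      rwa [mul_comm]
  rcases K.eq_empty_or_nonempty with hE | hE
  · exact ⟨0, le_rfl, one_pos, hscale 0 fun v hv => by simp [hE] at hv⟩
  · obtain ⟨w, hw, hmax⟩ := hK.exists_isMaxOn hE (continuous_drLin hu A).norm.continuousOn
    refine ⟨‖drLin A u w‖, norm_nonneg _, ?_, hscale _ fun v hv => hmax hv⟩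
    have hw1 : ‖w‖ = 1 := by simpa using hw.1
    refine lt_of_le_of_ne (hw1 ▸ norm_drLin_le hu A w) fun heq => ?_
    have h1 := norm_drLin_sq_add hu A w
    rw [heq, hw1] at h1
    have h2 : ‖w - drLin A u w‖ = 0 := by
      have : ‖w - drLin A u w‖ ^ 2 = 0 := by linarith
      simpa using this
    have h3 : drLin A u w = w := (sub_eq_zero.1 (norm_eq_zero.1 h2)).symm
    have := h w hw.2 h3
    rw [this, norm_zero] at hw1
    exact zero_ne_one hw1

end PhaseRetrieval
end

noncomputable section

namespace PhaseRetrieval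

variable {G : Type*} {m : ℕ}

/-! ### The Douglas–Rachford operator -/

/-- The reflection `2 prox - id` of the prior-free phase retrieval problem. -/
def magRefl (b : Fin m → ℝ) (z : Stacked G m) : Stacked G m :=
  stack z.fst ((2 : ℂ) • proxF b z.snd - z.snd)

@[simp] theorem magRefl_fst (b : Fin m → ℝ) (z : Stacked G m) : (magRefl b z).fst = z.fst := rfl

@[simp] theorem magRefl_snd (b : Fin m → ℝ) (z : Stacked G m) (i : Fin m) :
    (magRefl b z).snd i = 2 * (b i * phase (z.snd i)) - z.snd i := rfl

theorem magRefl_smul (b : Fin m → ℝ) {α : ℂ} (hα : ‖α‖ = 1) (z : Stacked G m) :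
    magRefl b (α • z) = α • magRefl b z := by
  refine stacked_ext (by simp) fun i => ?_
  simp [phase_smul hα]
  ring

/-- The point `(x♮, (b + θ) ∘ u)`. -/
def shiftedPoint (b : Fin m → ℝ) (xnat : EuclideanSpace ℂ G) (u : Fin m → ℂ) (θ : Fin m → ℝ) :
    Stacked G m :=
  stack xnat (WithLp.toLp 2 fun i => ((b i + θ i : ℝ) : ℂ) * u i)

/-- The vector `(0, η ∘ u)`. -/
def radialVec (u : Fin m → ℂ) (η : Fin m → ℝ) : Stacked G m :=
  stack 0 (WithLp.toLp 2 fun i => (η i : ℂ) * u i)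

@[simp] theorem shiftedPoint_fst (b : Fin m → ℝ) (xnat : EuclideanSpace ℂ G) (u : Fin m → ℂ)
    (θ : Fin m → ℝ) : (shiftedPoint b xnat u θ).fst = xnat := rfl

@[simp] theorem shiftedPoint_snd (b : Fin m → ℝ) (xnat : EuclideanSpace ℂ G) (u : Fin m → ℂ)
    (θ : Fin m → ℝ) (i : Fin m) :
    (shiftedPoint b xnat u θ).snd i = ((b i + θ i : ℝ) : ℂ) * u i := rfl

@[simp] theorem radialVec_fst (u : Fin m → ℂ) (η : Fin m → ℝ) :
    (radialVec u η : Stacked G m).fst = 0 := rfl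

@[simp] theorem radialVec_snd (u : Fin m → ℂ) (η : Fin m → ℝ) (i : Fin m) :
    (radialVec u η : Stacked G m).snd i = (η i : ℂ) * u i := rfl

theorem shiftedPoint_add (b : Fin m → ℝ) (xnat : EuclideanSpace ℂ G) (u : Fin m → ℂ)
    (θ η : Fin m → ℝ) (t : ℝ) :
    shiftedPoint b xnat u (fun i => θ i + t * η i) =
      shiftedPoint b xnat u θ + (t : ℂ) • radialVec u η := by
  refine stacked_ext (by simp) fun i => ?_
  simp
  ring

variable [Fintype G]

/-- One step of graph projection splitting, as a Douglas–Rachford step. -/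
def drStep (A : Matrix G (Fin m) ℂ) (b : Fin m → ℝ) (z : Stacked G m) : Stacked G m :=
  (1 / 2 : ℂ) • (z + (graphSet A).reflection (magRefl b z))

variable {A : Matrix G (Fin m) ℂ} {b : Fin m → ℝ} {xnat : EuclideanSpace ℂ G} {u : Fin m → ℂ}

/-- This equivariance allows a nearest point to be rotated to one with `α = 1`. -/
theorem drStep_smul {α : ℂ} (hα : ‖α‖ = 1) (z : Stacked G m) :
    drStep A b (α • z) = α • drStep A b z := by
  simp only [drStep, magRefl_smul b hα, map_smul]
  module

/-- Since `g = 0`, the dual variable `λ` vanishes after one step, and `y` is then the prox of `ν +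
y`, so the sum determines the next iterate. Neither need hold for the arbitrary initial values,
hence the index shift. -/
theorem IsGPS.drStep_eq {x xh lam : ℕ → EuclideanSpace ℂ G}
    {y yh nu : ℕ → EuclideanSpace ℂ (Fin m)} (h : IsGPS A b x xh lam y yh nu) (k : ℕ) :
    stack (lam (k + 2) + x (k + 2)) (nu (k + 2) + y (k + 2)) =
      drStep A b (stack (lam (k + 1) + x (k + 1)) (nu (k + 1) + y (k + 1))) := by
  have hlam : ∀ j, lam (j + 1) = 0 := fun j => by
    rw [h.dual_x j, h.prox_x j, proxG]; abel
  have hy : proxF b (nu (k + 1) + y (k + 1)) = y (k + 1) := by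
    rw [h.dual_y k, sub_add_cancel, h.prox_y k, add_comm]
  have hg := h.graph_step (k + 1)
  rw [hlam k, sub_zero] at hg
  have hm : magRefl b (stack (lam (k + 1) + x (k + 1)) (nu (k + 1) + y (k + 1))) =
      stack (x (k + 1)) (y (k + 1) - nu (k + 1)) := by
    rw [magRefl, stack_fst, stack_snd, hy, hlam k, zero_add]
    congr 1
    module
  rw [drStep, hm, Submodule.reflection_apply]
  change _ = (1 / 2 : ℂ) • (_ + (2 • graphProj A _ - _))
  rw [← hg, hlam k, hlam (k + 1), h.prox_x (k + 1), h.dual_y (k + 1), hlam k]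
  refine stacked_ext ?_ fun i => ?_
  · simp [proxG]
    module
  · simp
    ring

theorem radialVec_mem_orthogonal {η : Fin m → ℝ} (h : A *ᵥ (fun i => (η i : ℂ) * u i) = 0) :
    radialVec u η ∈ (graphSet A)ᗮ := by
  rw [Submodule.mem_orthogonal]
  intro w hw
  have hw' : meas A w.fst = w.snd := hw
  have h1 : ∀ i, conj (w.snd i) = ∑ j, A j i * conj (w.fst j) := fun i => by
    rw [← hw']
    simp [meas, Matrix.mulVec, dotProduct]
  rw [inner_stacked]
  simp only [radialVec_fst, inner_zero_right, zero_add, radialVec_snd, h1, Finset.mul_sum]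
  rw [Finset.sum_comm]
  refine Finset.sum_eq_zero fun j _ => ?_
  have h2 : ∑ i, A j i * ((η i : ℂ) * u i) = 0 := congrFun h j
  calc _ = (∑ i, A j i * ((η i : ℂ) * u i)) * conj (w.fst j) := by
        rw [Finset.sum_mul]
        exact Finset.sum_congr rfl fun i _ => by ring
    _ = 0 := by rw [h2, zero_mul]

/-- `magRefl` turns `b + θ` into `b - θ`; the graph reflection turns it back, because the radial
vector of `θ` is orthogonal to the graph. -/
theorem drStep_shiftedPoint (hu : ∀ i, ‖u i‖ = 1) (hy : ∀ i, meas A xnat i = b i * u i)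
    {θ : Fin m → ℝ} (hθ : A *ᵥ (fun i => (θ i : ℂ) * u i) = 0) (hpos : ∀ i, 0 < b i + θ i) :
    drStep A b (shiftedPoint b xnat u θ) = shiftedPoint b xnat u θ := by
  have h1 : magRefl b (shiftedPoint b xnat u θ) = stack xnat (meas A xnat) - radialVec u θ := by
    refine stacked_ext (by simp) fun i => ?_
    simp [phase_real_mul (hu i) (hpos i), hy, -Complex.ofReal_add]
    push_cast
    ring
  have h2 : (graphSet A).reflection (stack xnat (meas A xnat)) = stack xnat (meas A xnat) :=
    Submodule.reflection_mem_subspace_eq_self (show _ ∈ graphSet A from rfl)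
  have h3 : (graphSet A).reflection (radialVec u θ) = -radialVec u θ :=
    Submodule.reflection_mem_subspace_orthogonalComplement_eq_neg (radialVec_mem_orthogonal hθ)
  rw [drStep, h1, map_sub, h2, h3]
  refine stacked_ext ?_ fun i => ?_
  · simp; module
  · simp [hy]; ring

/-- The Douglas–Rachford step differs from its linearization at the solution by a small multiple of
the displacement. -/
theorem norm_drStep_sub_drLin_le (hu : ∀ i, ‖u i‖ = 1) {β ε : ℝ} (hβ : 0 < β)
    (hb : ∀ i, β ≤ b i) (hε : 6 * ε ≤ β) {θ : Fin m → ℝ} (hθ : ∀ i, |θ i| ≤ 2 * ε)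
    {v : Stacked G m} (hv : ‖v‖ ≤ ε) :
    ‖drStep A b (shiftedPoint b xnat u θ + v) - drStep A b (shiftedPoint b xnat u θ) -
      drLin A u v‖ ≤ 10 * ε / β * ‖v‖ := by
  have hε0 : 0 ≤ ε := (norm_nonneg v).trans hv
  set p := shiftedPoint b xnat u θ with hp
  set e := magRefl b (p + v) - magRefl b p - phaseRefl u v with he
  -- The graph reflection is a linear isometry, so only the error `e` of linearizing `magRefl`
  -- matters, and its `x`-part is zero.
  have h1 : drStep A b (p + v) - drStep A b p - drLin A u v =
      (1 / 2 : ℂ) • (graphSet A).reflection e := by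
    simp only [drStep, drLin, he, map_sub]
    module
  have h2 : ‖e‖ ≤ 20 * ε / β * ‖v‖ := by
    refine norm_stacked_le (by positivity) ?_ fun i => ?_
    · have : e.fst = 0 := by simp [he]
      rw [this, norm_zero]; positivity
    · have hbi : 0 < b i := hβ.trans_le (hb i)
      have hpos : 0 < b i + θ i := by linarith [hb i, (abs_le.1 (hθ i)).1]
      have h3 : e.snd i = 2 * ((b i : ℂ) * phase (((b i + θ i : ℝ) : ℂ) * u i + v.snd i) -
          b i * u i - (v.snd i - u i ^ 2 * conj (v.snd i)) / 2) := by
        simp only [he, hp, WithLp.sub_snd, WithLp.add_snd, PiLp.sub_apply, PiLp.add_apply,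
          magRefl_snd, shiftedPoint_snd, phaseRefl_snd, phase_real_mul (hu i) hpos]
        ring
      have h4 := norm_phase_sub_linear_le (ρ := b i + θ i) (hu i) hbi (hε.trans (hb i))
        (by simpa using hθ i) ((norm_snd_le v i).trans hv)
      rw [h3, norm_mul, Complex.norm_ofNat]
      calc _ ≤ 2 * (10 * ε / b i * ‖v.snd i‖) := by gcongr
        _ ≤ 2 * (10 * ε / β * ‖v.snd i‖) := by gcongr; exact hb i
        _ = _ := by ring
  rw [h1, norm_smul, LinearIsometryEquiv.norm_map]
  calc _ ≤ ‖(1 / 2 : ℂ)‖ * (20 * ε / β * ‖v‖) := by gcongr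
    _ = _ := by norm_num; ring

/-- The factor `γ` is available for vectors normal at the solution, whereas `v` is normal at the
shifted point. The two conditions differ by a component `w` along `i z₀` of size at most `2 ε / β *
‖v‖`. This costs `4 ε / β`, and the linearization costs `10 ε / β`. -/
theorem norm_drStep_shiftedPoint_sub_le (hu : ∀ i, ‖u i‖ = 1)
    (hy : ∀ i, meas A xnat i = b i * u i) {β ε γ : ℝ} (hβ : 0 < β)
    (hb : ∀ i, β ≤ b i) (hε : 6 * ε ≤ β) (hz : β ≤ ‖stack xnat (meas A xnat)‖)
    (hγ0 : 0 ≤ γ) (hγ1 : γ ≤ 1)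
    (hγ : ∀ v ∈ normalSet A u (stack xnat (meas A xnat)), ‖drLin A u v‖ ≤ γ * ‖v‖)
    {θ : Fin m → ℝ} (hAθ : A *ᵥ (fun i => (θ i : ℂ) * u i) = 0)
    (hθ : ‖(radialVec u θ : Stacked G m)‖ ≤ 2 * ε)
    {v : Stacked G m} (hv : ‖v‖ ≤ ε) (hvn : v ∈ normalSet A u (shiftedPoint b xnat u θ)) :
    ‖drStep A b (shiftedPoint b xnat u θ + v) - shiftedPoint b xnat u θ‖ ≤
      (γ + 14 * ε / β) * ‖v‖ := by
  have hε0 : 0 ≤ ε := (norm_nonneg v).trans hv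
  have hθi : ∀ i, |θ i| ≤ 2 * ε := fun i => by
    have := (norm_snd_le (radialVec u θ : Stacked G m) i).trans hθ
    simpa [hu] using this
  have hpos : ∀ i, 0 < b i + θ i := fun i => by linarith [hb i, (abs_le.1 (hθi i)).1]
  have hmain := norm_drStep_sub_drLin_le (A := A) (xnat := xnat) hu hβ hb hε hθi hv
  rw [drStep_shiftedPoint hu hy hAθ hpos] at hmain
  set z₀ := stack xnat (meas A xnat) with hz₀
  have hz0 : 0 < ‖z₀‖ := hβ.trans_le hz
  set c : ℝ := (inner ℂ z₀ v).im / ‖z₀‖ ^ 2 with hc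
  set w : Stacked G m := (((c : ℝ) : ℂ) * Complex.I) • z₀ with hw
  have hw_norm : ‖w‖ ≤ 2 * ε / β * ‖v‖ := by
    have h1 : shiftedPoint b xnat u θ = z₀ + radialVec u θ := by
      refine stacked_ext (by simp [hz₀]) fun i => ?_
      simp [hz₀, hy]
      ring
    have h2 : (inner ℂ z₀ v).im = -(inner ℂ (radialVec u θ) v).im := by
      have := hvn.1
      rw [h1, inner_add_left, Complex.add_im] at this
      linarith
    have h3 : |(inner ℂ z₀ v).im| ≤ 2 * ε * ‖v‖ := by
      rw [h2, abs_neg]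
      calc _ ≤ ‖inner ℂ (radialVec u θ) v‖ := Complex.abs_im_le_norm _
        _ ≤ ‖(radialVec u θ : Stacked G m)‖ * ‖v‖ := norm_inner_le_norm _ _
        _ ≤ _ := by gcongr
    have h4 : ‖w‖ = |(inner ℂ z₀ v).im| / ‖z₀‖ := by
      rw [hw, norm_smul, norm_mul, Complex.norm_I, mul_one, Complex.norm_real, Real.norm_eq_abs,
        hc, abs_div, abs_of_pos (by positivity : 0 < ‖z₀‖ ^ 2)]
      field_simp
    rw [h4]
    calc _ ≤ 2 * ε * ‖v‖ / β := by gcongr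
      _ = _ := by ring
  have hvw : v - w ∈ normalSet A u z₀ := by
    refine ⟨?_, fun η hη => ?_⟩
    · have h1 : (inner ℂ z₀ w).im = c * ‖z₀‖ ^ 2 := by
        rw [hw, inner_smul_right, inner_self_eq_norm_sq_to_K, mul_assoc, Complex.im_ofReal_mul]
        congr 1
        change (Complex.I * ((‖z₀‖ : ℝ) : ℂ) ^ 2).im = _
        rw [← Complex.ofReal_pow, Complex.im_mul_ofReal, Complex.I_im, one_mul]
      rw [inner_sub_right, Complex.sub_im, h1, hc]
      field_simp
      ring
    -- The `y`-part of `i z₀` is `i b ∘ u`, which has no radial component, so removing `w` preserves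
    -- the second condition.
    · rw [← hvn.2 η hη]
      refine Finset.sum_congr rfl fun i _ => ?_
      have h1 : conj (u i) * (v - w).snd i =
          conj (u i) * v.snd i - ((c * b i : ℝ) : ℂ) * Complex.I := by
        simp only [hw, hz₀, WithLp.sub_snd, WithLp.smul_snd, PiLp.sub_apply, PiLp.smul_apply,
          stack_snd, hy, smul_eq_mul]
        push_cast
        linear_combination (-(c * Complex.I * b i : ℂ)) * mul_conj_eq_one (hu i)
      rw [h1, Complex.sub_re, Complex.re_ofReal_mul, Complex.I_re, mul_zero, sub_zero]
  have hlin : ‖drLin A u v‖ ≤ (γ + 4 * ε / β) * ‖v‖ := by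
    have h1 : drLin A u v = drLin A u (v - w) + drLin A u w := by
      rw [← drLin_add, sub_add_cancel]
    rw [h1]
    calc _ ≤ γ * ‖v - w‖ + ‖w‖ :=
          (norm_add_le _ _).trans (add_le_add (hγ _ hvw) (norm_drLin_le hu A w))
      _ ≤ γ * (‖v‖ + ‖w‖) + ‖w‖ := by gcongr; exact norm_sub_le _ _
      _ ≤ γ * ‖v‖ + 1 * ‖w‖ + ‖w‖ := by rw [mul_add]; gcongr
      _ ≤ γ * ‖v‖ + 1 * (2 * ε / β * ‖v‖) + 2 * ε / β * ‖v‖ := by gcongr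
      _ = _ := by ring
  calc _ = ‖(drStep A b (shiftedPoint b xnat u θ + v) - shiftedPoint b xnat u θ - drLin A u v) +
        drLin A u v‖ := by rw [sub_add_cancel]
    _ ≤ 10 * ε / β * ‖v‖ + (γ + 4 * ε / β) * ‖v‖ :=
        (norm_add_le _ _).trans (add_le_add hmain hlin)
    _ = _ := by ring

end PhaseRetrieval
end

noncomputable section

namespace PhaseRetrieval

variable {G : Type*} [Fintype G] {m : ℕ}
variable {A : Matrix G (Fin m) ℂ} {b : Fin m → ℝ} {xnat : EuclideanSpace ℂ G}

/-! ### Projections onto the fixed set -/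

theorem mem_fixedSet_iff {z : Stacked G m} : z ∈ fixedSet A b xnat ↔
    ∃ (α : ℂ) (θ : Fin m → ℝ), ‖α‖ = 1 ∧
      A *ᵥ (fun i => (θ i : ℂ) * phase (meas A xnat i)) = 0 ∧ (∀ i, 0 ≤ b i + θ i) ∧
      z = α • shiftedPoint b xnat (fun i => phase (meas A xnat i)) θ := by
  have h : ∀ (α : ℂ) (θ : Fin m → ℝ), stack (α • xnat)
      (WithLp.toLp 2 fun i => α * ((b i + θ i : ℝ) : ℂ) * phase (meas A xnat i)) =
      α • shiftedPoint b xnat (fun i => phase (meas A xnat i)) θ := fun α θ => by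
    refine stacked_ext (by simp) fun i => ?_
    simp
    ring
  simp only [fixedSet, Set.mem_ofPred_eq, h]

theorem smul_mem_fixedSet {α : ℂ} (hα : ‖α‖ = 1) {z : Stacked G m}
    (hz : z ∈ fixedSet A b xnat) : α • z ∈ fixedSet A b xnat := by
  obtain ⟨α', θ, h1, h2, h3, rfl⟩ := mem_fixedSet_iff.1 hz
  exact mem_fixedSet_iff.2 ⟨α * α', θ, by simp [hα, h1], h2, h3, smul_smul _ _ _⟩

theorem solution_mem_fixedSet (hsol : IsSolution A b xnat) :
    stack xnat (meas A xnat) ∈ fixedSet A b xnat := by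
  refine mem_fixedSet_iff.2 ⟨1, 0, by simp, ?_, fun i => ?_, ?_⟩
  · ext j; simp [Matrix.mulVec, dotProduct]
  · simp [← hsol i]
  · refine stacked_ext (by simp) fun i => ?_
    simp [← hsol i, norm_mul_phase]

theorem IsProjOn.norm_sub_le {S : Set (Stacked G m)} {z p q : Stacked G m} (h : IsProjOn S z p)
    (hq : q ∈ S) : ‖z - p‖ ≤ ‖z - q‖ := by
  rw [norm_sub_rev z p, norm_sub_rev z q]
  exact le_of_sq_le_sq (h.2 q hq) (norm_nonneg _)

theorem IsProjOn.smul {z p : Stacked G m} (h : IsProjOn (fixedSet A b xnat) z p) {α : ℂ}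
    (hα : ‖α‖ = 1) : IsProjOn (fixedSet A b xnat) (α • z) (α • p) := by
  have hα0 : α ≠ 0 := by rintro rfl; simp at hα
  refine ⟨smul_mem_fixedSet hα h.1, fun q hq => ?_⟩
  have h1 := h.2 _ (smul_mem_fixedSet (α := α⁻¹) (by simp [hα]) hq)
  have h2 : q - α • z = α • (α⁻¹ • q - z) := by rw [smul_sub, smul_inv_smul₀ hα0]
  rwa [← smul_sub, h2, norm_smul, norm_smul, hα, one_mul, one_mul]

/-- Only points at least as close to `z` as the solution compete, and their parameters `(α, θ)` lie
in a compact set: `0 ≤ b + θ ≤ ‖z‖ + ‖z - z₀‖` entrywise, which dictates `R`. -/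
theorem exists_isProjOn_fixedSet (hb : ∀ i, 0 < b i) (hsol : IsSolution A b xnat)
    (z : Stacked G m) : ∃ p, IsProjOn (fixedSet A b xnat) z p := by
  have := properSpace_stacked (G := G) (m := m)
  set u : Fin m → ℂ := fun i => phase (meas A xnat i) with hu_def
  have hu : ∀ i, ‖u i‖ = 1 := fun i => norm_phase fun h => by
    have := hsol i
    rw [h, norm_zero] at this
    exact (hb i).ne this
  set z₀ := stack xnat (meas A xnat)
  set R : ℝ := ‖z‖ + ‖z - z₀‖ + ‖b‖ with hR
  set K : Set (ℂ × (Fin m → ℝ)) := (Metric.sphere 0 1 ×ˢ Metric.closedBall 0 R) ∩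
    {q | A *ᵥ (fun i => (q.2 i : ℂ) * u i) = 0 ∧ ∀ i, 0 ≤ b i + q.2 i} with hK_def
  set f : ℂ × (Fin m → ℝ) → Stacked G m := fun q => q.1 • shiftedPoint b xnat u q.2 with hf
  have hK : IsCompact K := by
    refine ((isCompact_sphere 0 1).prod (isCompact_closedBall 0 R)).inter_right ?_
    rw [Set.ofPred_and]
    refine IsClosed.inter (isClosed_eq (by fun_prop) continuous_const) ?_
    simp only [Set.ofPred_forall]
    exact isClosed_iInter fun i => isClosed_le continuous_const (by fun_prop)
  have hfc : Continuous f := by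
    refine Continuous.smul continuous_fst ?_
    refine (WithLp.prod_continuous_toLp 2 _ _).comp (continuous_const.prodMk ?_)
    exact (PiLp.continuous_toLp 2 _).comp (by fun_prop)
  have hmemK : ∀ q ∈ fixedSet A b xnat, ‖z - q‖ ≤ ‖z - z₀‖ → ∃ k ∈ K, f k = q := by
    intro q hq hle
    obtain ⟨α, θ, h1, h2, h3, rfl⟩ := mem_fixedSet_iff.1 hq
    refine ⟨(α, θ), ⟨⟨by simpa using h1, ?_⟩, h2, h3⟩, rfl⟩
    rw [mem_closedBall_zero_iff, pi_norm_le_iff_of_nonneg (by positivity)]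
    intro i
    have h4 : ‖α • shiftedPoint b xnat u θ‖ ≤ ‖z‖ + ‖z - z₀‖ := by
      have := norm_sub_norm_le (α • shiftedPoint b xnat u θ) z
      rw [norm_sub_rev] at this
      linarith
    have h5 : b i + θ i ≤ ‖z‖ + ‖z - z₀‖ := by
      have := (norm_snd_le _ i).trans h4
      simp only [WithLp.smul_snd, PiLp.smul_apply, shiftedPoint_snd, norm_smul, norm_mul, h1,
        hu, Complex.norm_real, one_mul, mul_one, Real.norm_of_nonneg (h3 i)] at this
      exact this
    have h6 : b i ≤ ‖b‖ := (le_abs_self _).trans (norm_le_pi_norm b i)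
    rw [Real.norm_eq_abs, abs_le]
    constructor
    · linarith [h3 i, norm_nonneg z, norm_nonneg (z - z₀)]
    · linarith [hb i, norm_nonneg b]
  obtain ⟨k₀, hk₀, hfk₀⟩ := hmemK z₀ (solution_mem_fixedSet hsol) le_rfl
  obtain ⟨k, hk, hmin⟩ := hK.exists_isMinOn ⟨k₀, hk₀⟩
    (continuous_const.sub hfc).norm.continuousOn (f := fun q => ‖z - f q‖)
  have hk₁ : ‖z - f k‖ ≤ ‖z - z₀‖ := by rw [← hfk₀]; exact hmin hk₀
  refine ⟨f k, mem_fixedSet_iff.2 ⟨k.1, k.2, by simpa using hk.1.1, hk.2.1, hk.2.2, rfl⟩,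
    fun q hq => ?_⟩
  rw [norm_sub_rev _ z, norm_sub_rev _ z]
  refine pow_le_pow_left₀ (norm_nonneg _) ?_ 2
  rcases le_total ‖z - q‖ ‖z - z₀‖ with hle | hle
  · obtain ⟨k', hk', rfl⟩ := hmemK q hq hle
    exact hmin hk'
  · exact hk₁.trans hle

/-- Taking `α = phase w` gives `‖w‖ ≤ w.re`. -/
theorem im_eq_zero_of_forall_re_le {w : ℂ} (h : ∀ α : ℂ, ‖α‖ = 1 → (conj α * w).re ≤ w.re) :
    w.im = 0 := by
  by_cases hw : w = 0
  · simp [hw]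
  have hp := norm_phase hw
  have h1 := h (phase w) hp
  have h2 : conj (phase w) * w = (‖w‖ : ℂ) := by
    conv_lhs => rw [← norm_mul_phase w, phase_real_mul hp (norm_pos_iff.2 hw)]
    linear_combination (‖w‖ : ℂ) * mul_conj_eq_one hp
  rw [h2, Complex.ofReal_re] at h1
  exact Complex.abs_re_eq_norm.1
    (le_antisymm (Complex.abs_re_le_norm w) (h1.trans (le_abs_self _)))

/-- First-order optimality of a nearest point of the fixed set. -/
theorem IsProjOn.sub_mem_normalSet {z : Stacked G m} {θ : Fin m → ℝ}
    (hAθ : A *ᵥ (fun i => (θ i : ℂ) * phase (meas A xnat i)) = 0) (hpos : ∀ i, 0 < b i + θ i)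
    (h : IsProjOn (fixedSet A b xnat) z
      (shiftedPoint b xnat (fun i => phase (meas A xnat i)) θ)) :
    z - shiftedPoint b xnat (fun i => phase (meas A xnat i)) θ ∈
      normalSet A (fun i => phase (meas A xnat i))
        (shiftedPoint b xnat (fun i => phase (meas A xnat i)) θ) := by
  set u : Fin m → ℂ := fun i => phase (meas A xnat i) with hu_def
  set p := shiftedPoint b xnat u θ with hp
  refine ⟨?_, fun η hη => ?_⟩
  · have h1 : (inner ℂ p z).im = 0 := by
      refine im_eq_zero_of_forall_re_le fun α hα => ?_
      have h2 := h.2 _ (smul_mem_fixedSet hα h.1)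
      rw [norm_sub_sq (𝕜 := ℂ), norm_sub_sq (𝕜 := ℂ), norm_smul, hα, one_mul,
        inner_smul_left] at h2
      change _ - 2 * (inner ℂ p z).re + _ ≤ _ - 2 * (conj α * inner ℂ p z).re + _ at h2
      linarith
    rw [inner_sub_right, Complex.sub_im, h1]
    have : (inner ℂ p p).im = 0 := inner_self_im (𝕜 := ℂ) p
    rw [this, sub_zero]
  · set a : ℝ := (inner ℂ (p - z) (radialVec u η)).re with ha
    set g : ℝ → ℝ := fun t => ‖p - z‖ ^ 2 + 2 * (t * a) +
      t ^ 2 * ‖(radialVec u η : Stacked G m)‖ ^ 2 with hg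
    have hgt : ∀ t : ℝ, g t = ‖shiftedPoint b xnat u (fun i => θ i + t * η i) - z‖ ^ 2 :=
      fun t => by
      rw [shiftedPoint_add, add_sub_right_comm, norm_add_sq (𝕜 := ℂ), inner_smul_right, norm_smul,
        mul_pow, Complex.norm_real, Real.norm_eq_abs, sq_abs]
      change _ = _ + 2 * ((t : ℂ) * inner ℂ (p - z) (radialVec u η)).re + _
      rw [Complex.re_ofReal_mul]
    -- Strict positivity of `b + θ` makes small `t` of both signs admissible, so the derivative
    -- vanishes instead of merely having a sign.
    have hmin : IsLocalMin g 0 := by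
      have hev : ∀ i, ∀ᶠ t : ℝ in nhds 0, 0 < b i + (θ i + t * η i) := fun i => by
        have hcont : Filter.Tendsto (fun t : ℝ => b i + (θ i + t * η i)) (nhds 0)
            (nhds (b i + (θ i + 0 * η i))) :=
          (by fun_prop : Continuous fun t : ℝ => b i + (θ i + t * η i)).tendsto 0
        exact hcont.eventually (lt_mem_nhds (by simpa using hpos i))
      filter_upwards [Filter.eventually_all.2 hev] with t ht
      have h0 : g 0 = ‖p - z‖ ^ 2 := by simp [hg]
      rw [h0, hgt t]
      refine h.2 _ (mem_fixedSet_iff.2 ⟨1, _, by simp, ?_, fun i => (ht i).le,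
        (one_smul _ _).symm⟩)
      have : (fun i => ((θ i + t * η i : ℝ) : ℂ) * phase (meas A xnat i)) =
          (fun i => (θ i : ℂ) * phase (meas A xnat i)) +
            (t : ℂ) • (fun i => (η i : ℂ) * u i) := by
        funext i
        simp [hu_def]
        ring
      rw [this, Matrix.mulVec_add, Matrix.mulVec_smul, hAθ, hη, smul_zero, add_zero]
    have hder : HasDerivAt g (2 * a) 0 := by
      have h1 : HasDerivAt (fun t : ℝ => t * a) (1 * a) 0 := (hasDerivAt_id 0).mul_const a
      have h2 := (((h1.const_mul 2).const_add (‖p - z‖ ^ 2)).add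
        ((hasDerivAt_pow 2 (0 : ℝ)).mul_const (‖(radialVec u η : Stacked G m)‖ ^ 2)))
      refine h2.congr_deriv ?_
      simp
    have ha0 : a = 0 := by
      have := hmin.hasDerivAt_eq_zero hder
      linarith
    have h3 : a = -∑ i, η i * (conj (u i) * (z - p).snd i).re := by
      rw [ha, inner_stacked, radialVec_fst, inner_zero_right, zero_add, Complex.re_sum,
        ← Finset.sum_neg_distrib]
      refine Finset.sum_congr rfl fun i _ => ?_
      rw [radialVec_snd]
      simp
      ring
    linarith

/-! ### Local contraction and the resulting linear rate -/

/-- Near the solution, the Douglas–Rachford step contracts towards the nearest point of the fixed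
set. -/
theorem exists_norm_drStep_sub_le {β : ℝ} (hβ : 0 < β) (hm : 0 < m) (hb : ∀ i, β ≤ b i)
    (hsol : IsSolution A b xnat)
    (hmag : ∀ x : EuclideanSpace ℂ G,
      (∀ i, phase (meas A x i) = phase (meas A xnat i) ∨
        phase (meas A x i) = -phase (meas A xnat i)) →
      ∃ c : ℝ, c ≠ 0 ∧ x = (c : ℂ) • xnat) :
    ∃ ε : ℝ, 0 < ε ∧ ε < β / 6 ∧ ∃ γ : ℝ, 0 < γ ∧ γ < 1 ∧ ∀ z p : Stacked G m,
      ‖z - stack xnat (meas A xnat)‖ ≤ ε → IsProjOn (fixedSet A b xnat) z p →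
      ‖drStep A b z - p‖ ≤ γ * ‖z - p‖ := by
  have hb0 : ∀ i, 0 < b i := fun i => hβ.trans_le (hb i)
  set u : Fin m → ℂ := fun i => phase (meas A xnat i) with hu_def
  have hy : ∀ i, meas A xnat i = b i * u i := fun i => by
    rw [← hsol i, hu_def, norm_mul_phase]
  have hu : ∀ i, ‖u i‖ = 1 := fun i => norm_phase fun h => by
    have := hsol i
    rw [h, norm_zero] at this
    exact (hb0 i).ne this
  set z₀ := stack xnat (meas A xnat) with hz₀
  have hzβ : β ≤ ‖z₀‖ := by
    have h1 := norm_snd_le z₀ ⟨0, hm⟩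
    rw [hz₀, stack_snd, hsol] at h1
    exact (hb _).trans h1
  have hne : xnat ≠ 0 := by
    rintro rfl
    have := hsol ⟨0, hm⟩
    simp [meas] at this
    exact (hb0 _).ne this
  obtain ⟨γ, hγ0, hγ1, hγ⟩ := exists_norm_drLin_le (A := A) (z₀ := z₀) hu fun v hv hfix =>
    eq_zero_of_drLin_eq_self hb0 hne hsol hmag hv hfix
  -- Chosen so that the loss `14 ε / β` is half of the gap `1 - γ`, which leaves the factor `(1 + γ)
  -- / 2`.
  set ε : ℝ := β * (1 - γ) / 28 with hε
  have hεβ : 14 * ε / β = (1 - γ) / 2 := by rw [hε]; field_simp; ring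
  have hε0 : 0 < ε := by
    have : 0 < 1 - γ := by linarith
    positivity
  have hε6 : ε < β / 6 := by rw [hε]; nlinarith
  refine ⟨ε, hε0, hε6, (1 + γ) / 2, by linarith, by linarith, fun z p hz hp => ?_⟩
  obtain ⟨α, θ, hα, hAθ, hθ, rfl⟩ := mem_fixedSet_iff.1 hp.1
  have hα0 : α ≠ 0 := by rintro rfl; simp at hα
  have hα' : ‖α⁻¹‖ = 1 := by simp [hα]
  have hle : ‖z - α • shiftedPoint b xnat u θ‖ ≤ ε :=
    (hp.norm_sub_le (solution_mem_fixedSet hsol)).trans hz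
  have hp' := hp.smul hα'
  rw [inv_smul_smul₀ hα0] at hp'
  set v := α⁻¹ • z - shiftedPoint b xnat u θ with hv
  have hzv : α⁻¹ • z = shiftedPoint b xnat u θ + v := by rw [hv]; abel
  have hzα : z = α • (shiftedPoint b xnat u θ + v) := by rw [← hzv, smul_inv_smul₀ hα0]
  have hvn : ‖v‖ = ‖z - α • shiftedPoint b xnat u θ‖ := by
    rw [hzα, ← smul_sub, norm_smul, hα, one_mul, add_sub_cancel_left]
  -- Entrywise, `|θ i|` is the difference of the moduli of the nearest point and the solution, and
  -- these two points are at most `2 ε` apart.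
  have hr : ‖(radialVec u θ : Stacked G m)‖ ≤ 2 * ε := by
    have h1 : ‖(radialVec u θ : Stacked G m)‖ ≤ 1 * ‖α • shiftedPoint b xnat u θ - z₀‖ := by
      refine norm_stacked_le zero_le_one (by simp) fun i => ?_
      have h2 := abs_norm_sub_norm_le (α * (((b i + θ i : ℝ) : ℂ) * u i)) (meas A xnat i)
      rw [hsol i, norm_mul, norm_mul, hα, hu, Complex.norm_real, Real.norm_of_nonneg (hθ i), one_mul,
        mul_one, add_sub_cancel_left] at h2
      rw [radialVec_snd, norm_mul, hu, Complex.norm_real, mul_one, Real.norm_eq_abs, one_mul]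
      exact h2
    have h3 : ‖α • shiftedPoint b xnat u θ - z₀‖ ≤
        ‖z - α • shiftedPoint b xnat u θ‖ + ‖z - z₀‖ := by
      rw [norm_sub_rev z]
      exact norm_sub_le_norm_sub_add_norm_sub _ _ _
    linarith
  have hθi : ∀ i, |θ i| ≤ 2 * ε := fun i => by
    have := (norm_snd_le (radialVec u θ : Stacked G m) i).trans hr
    simpa [hu] using this
  have hpos : ∀ i, 0 < b i + θ i := fun i => by linarith [hb i, (abs_le.1 (hθi i)).1]
  have hmain := norm_drStep_shiftedPoint_sub_le hu hy hβ hb (by linarith) hzβ hγ0 hγ1.le hγ hAθ hr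
    (hvn.le.trans hle) (hp'.sub_mem_normalSet hAθ hpos)
  rw [← hvn]
  conv_lhs => rw [hzα, drStep_smul hα, ← smul_sub, norm_smul, hα, one_mul]
  refine hmain.trans (le_of_eq ?_)
  rw [hεβ]
  ring

/-- A sequence that moves towards its nearest points on a set by a fixed factor near `z₀` stays
near `z₀` and approaches the set linearly. -/
theorem norm_sub_le_of_local_contraction {S : Set (Stacked G m)} {T : Stacked G m → Stacked G m}
    {z₀ : Stacked G m} {ε γ : ℝ} (hγ0 : 0 < γ) (hγ1 : γ < 1) (hz₀ : z₀ ∈ S)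
    (hex : ∀ z, ∃ p, IsProjOn S z p)
    (hT : ∀ z p, ‖z - z₀‖ ≤ ε → IsProjOn S z p → ‖T z - p‖ ≤ γ * ‖z - p‖)
    {z : ℕ → Stacked G m} (hz : ∀ k, z (k + 1) = T (z k))
    (h0 : ‖z 0 - z₀‖ * (1 + 2 / (1 - γ)) ≤ ε) {p₀ : Stacked G m} (hp₀ : IsProjOn S (z 0) p₀)
    (k : ℕ) {p : Stacked G m} (hp : IsProjOn S (z k) p) : ‖z k - p‖ ≤ γ ^ k * ‖z 0 - p₀‖ := by
  have hγ' : 0 < 1 - γ := by linarith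
  set d := ‖z 0 - p₀‖ with hd
  have hd0 : d ≤ ‖z 0 - z₀‖ := hp₀.norm_sub_le hz₀
  -- Step `k` moves the iterate by at most `2 γ ^ k d`, through a nearest point `p` of `z k`; the
  -- partial geometric sum bounds the drift. A nearest point of `z (k + 1)` is no farther from it
  -- than `p`.
  suffices H : ∀ k, ‖z k - z₀‖ ≤ ‖z 0 - z₀‖ + 2 * d * ((1 - γ ^ k) / (1 - γ)) ∧
      ∀ p, IsProjOn S (z k) p → ‖z k - p‖ ≤ γ ^ k * d from (H k).2 p hp
  intro k
  induction k with
  | zero => exact ⟨by simp, fun p hp => by simpa using hp.norm_sub_le hp₀.1⟩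
  | succ k ih =>
    obtain ⟨p, hp⟩ := hex (z k)
    have hpk := ih.2 p hp
    have hd_nonneg : 0 ≤ d := norm_nonneg _
    have hnear : ‖z k - z₀‖ ≤ ε := by
      refine ih.1.trans (le_trans ?_ h0)
      have h1 : (1 - γ ^ k) / (1 - γ) ≤ 1 / (1 - γ) := by
        gcongr
        linarith [pow_pos hγ0 k]
      have h2 : 0 ≤ (1 - γ ^ k) / (1 - γ) :=
        div_nonneg (sub_nonneg.2 (pow_le_one₀ hγ0.le hγ1.le)) hγ'.le
      calc _ ≤ ‖z 0 - z₀‖ + 2 * ‖z 0 - z₀‖ * (1 / (1 - γ)) := by gcongr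
        _ = _ := by ring
    have hstep : ‖z (k + 1) - p‖ ≤ γ ^ (k + 1) * d := by
      rw [hz k]
      calc _ ≤ γ * ‖z k - p‖ := hT _ _ hnear hp
        _ ≤ γ * (γ ^ k * d) := by gcongr
        _ = _ := by ring
    refine ⟨?_, fun q hq => (hq.norm_sub_le hp.1).trans hstep⟩
    have h2 : ‖z (k + 1) - z₀‖ ≤ ‖z (k + 1) - p‖ + ‖z k - p‖ + ‖z k - z₀‖ := by
      have e : z (k + 1) - z₀ = (z (k + 1) - p) - (z k - p) + (z k - z₀) := by abel
      rw [e]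
      exact (norm_add_le _ _).trans (by gcongr; exact norm_sub_le _ _)
    have h3 : γ ^ (k + 1) * d ≤ γ ^ k * d :=
      mul_le_mul_of_nonneg_right (pow_le_pow_of_le_one hγ0.le hγ1.le (Nat.le_succ k)) hd_nonneg
    have h4 : 2 * d * ((1 - γ ^ (k + 1)) / (1 - γ)) =
        2 * d * ((1 - γ ^ k) / (1 - γ)) + 2 * (γ ^ k * d) := by
      field_simp
      ring
    linarith [ih.1]

theorem phaseDist_fst_le {z p : Stacked G m} (hp : p ∈ fixedSet A b xnat) :
    phaseDist z.fst xnat ≤ ‖z - p‖ := by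
  obtain ⟨α, θ, hα, -, -, rfl⟩ := mem_fixedSet_iff.1 hp
  have hbdd : BddBelow (Set.range fun α : Circle => ‖z.fst - (α : ℂ) • xnat‖) :=
    ⟨0, by rintro _ ⟨α, rfl⟩; exact norm_nonneg _⟩
  refine (ciInf_le hbdd ⟨α, mem_sphere_zero_iff_norm.2 hα⟩).trans ?_
  exact norm_fst_le (z - α • shiftedPoint b xnat (fun i => phase (meas A xnat i)) θ)

end PhaseRetrieval
end

theorem theorem3p1 {G : Type*} [Fintype G] [AddCommGroup G] {m : ℕ}
    (A : Matrix G (Fin m) ℂ) (b : Fin m → ℝ) (xnat : EuclideanSpace ℂ G)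
    (hb : 0 < PhaseRetrieval.bMin b)
    (hsol : PhaseRetrieval.IsSolution A b xnat)
    (hA : PhaseRetrieval.SamplingAssumption A b xnat) :
    ∃ ε₃ : ℝ, 0 < ε₃ ∧ ε₃ < PhaseRetrieval.bMin b / 6 ∧
      ∃ γ : ℝ, 0 < γ ∧ γ < 1 ∧
        ∀ (x xh lam : ℕ → EuclideanSpace ℂ G) (y yh nu : ℕ → EuclideanSpace ℂ (Fin m)),
          PhaseRetrieval.IsGPS A b x xh lam y yh nu →
          ∀ zDR : ℕ → PhaseRetrieval.Stacked G m,
            (∀ k, zDR k = PhaseRetrieval.stack (lam k + x k) (nu k + y k)) →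
            ‖zDR 1 - PhaseRetrieval.stack xnat (PhaseRetrieval.meas A xnat)‖ ≤ ε₃ →
            (∃ zstar, PhaseRetrieval.IsProjOn
              (PhaseRetrieval.fixedSet A b xnat) (zDR 1) zstar) ∧
            ∀ zstar, PhaseRetrieval.IsProjOn
                (PhaseRetrieval.fixedSet A b xnat) (zDR 1) zstar →
              ∀ k : ℕ, 1 ≤ k →
                PhaseRetrieval.phaseDist (x k) xnat ≤ γ ^ (k - 1) * ‖zDR 1 - zstar‖ ∧
                γ ^ (k - 1) * ‖zDR 1 - zstar‖ ≤
                  γ ^ (k - 1) *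
                    ‖zDR 1 - PhaseRetrieval.stack xnat (PhaseRetrieval.meas A xnat)‖ := by
  -- The infimum over an empty index set is 0.
  have hm : 0 < m := by
    rcases Nat.eq_zero_or_pos m with rfl | h
    · simp [PhaseRetrieval.bMin] at hb
    · exact h
  have hbi : ∀ i, PhaseRetrieval.bMin b ≤ b i := fun i =>
    ciInf_le (Set.finite_range b).bddBelow i
  have hb0 : ∀ i, 0 < b i := fun i => hb.trans_le (hbi i)
  obtain ⟨ε, hε0, hε6, γ, hγ0, hγ1, hT⟩ :=
    PhaseRetrieval.exists_norm_drStep_sub_le hb hm hbi hsol hA.magnitude_unique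
  have hγ' : 0 < 1 - γ := by linarith
  have hc : 1 < 1 + 2 / (1 - γ) := by linarith [div_pos two_pos hγ']
  have hex := PhaseRetrieval.exists_isProjOn_fixedSet hb0 hsol
  -- The contraction radius `ε` is shrunk to leave room for the total drift `2 d / (1 - γ)`.
  refine ⟨ε / (1 + 2 / (1 - γ)), by positivity, (div_lt_self hε0 hc).trans hε6, γ, hγ0, hγ1, ?_⟩
  intro x xh lam y yh nu hgps zDR hz hclose
  refine ⟨hex _, fun zstar hstar k hk => ?_⟩
  have hmem := PhaseRetrieval.solution_mem_fixedSet hsol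
  refine ⟨?_, mul_le_mul_of_nonneg_left (hstar.norm_sub_le hmem) (by positivity)⟩
  obtain ⟨j, rfl⟩ : ∃ j, k = j + 1 := ⟨k - 1, by omega⟩
  rw [Nat.add_sub_cancel]
  obtain ⟨p, hp⟩ := hex (zDR (j + 1))
  have hrec : ∀ k, zDR (k + 1 + 1) = PhaseRetrieval.drStep A b (zDR (k + 1)) := fun k => by
    rw [hz, hz (k + 1)]
    exact hgps.drStep_eq k
  have hmain := PhaseRetrieval.norm_sub_le_of_local_contraction (z := fun k => zDR (k + 1))
    hγ0 hγ1 hmem hex hT hrec ((le_div_iff₀ (by positivity)).1 hclose) hstar j hp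
  have hx : x (j + 1) = (zDR (j + 1)).fst := by
    rw [hz, PhaseRetrieval.stack_fst, hgps.dual_x j, hgps.prox_x j, PhaseRetrieval.proxG]
    abel
  rw [hx]
  exact (PhaseRetrieval.phaseDist_fst_le hp.1).trans hmain
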